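/- Let $k$ be a field of characteristic zero and let $P$ be a (symmetric, unital) dg operad over $k$, with arities $n\ge 0$, cohomologically $\mathbb{Z}$-graded (differential of degree $+1$, no boundedness or finiteness assumption). Let $H(P)$ be its cohomology, an operad in graded vector spaces, and assume that $H(P)(0)=0$ and $H(P)(1)\cong k$ (concentrated in degree $0$). For $q\in k^\times$ let $\phi_q$ be the grading automorphism of $H(P)$, that is, the automorphism which is multiplication by $q^i$ on the degree $i$ part $H^i(P)(n)$ for all $n$ and $i$. Suppose that for some $q\in k^\times$ that is not a root of unity, $\phi_q$ lifts to $P$: there is an automorphism $\sigma$ of the dg operad $P$ with $H(\sigma)=\phi_q$. Then $P$ is formal, i.e. $P$ and $H(P)$ (regarded as a dg operad with zero differential) are connected by a finite chain of quasi-isomorphisms of dg operads. -/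

import Mathlib

open CategoryTheory

universe v u

namespace Operadic

/-! ### Inputs of a partial composition -/

/-- The labelling of the `p = m + n - 1` inputs of a partial composition `f ∘ₐ g`, where `f` has
`m` inputs and `g` has `n` inputs: the inputs of `g` are put, in order, in the place of the
input `a` of `f`. -/
def insertFun {m n p : ℕ} (h : m + n = p + 1) (a : Fin m) :
    {x : Fin m // x ≠ a} ⊕ Fin n → Fin p
  | .inl x => if hx : x.1.1 < a.1 then ⟨x.1.1, by omega⟩
      else ⟨x.1.1 + n - 1, by
        have h1 := x.1.2
        have h2 : x.1.1 ≠ a.1 := fun e => x.2 (Fin.ext e)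
        omega⟩
  | .inr y => ⟨a.1 + y.1, by omega⟩

theorem insertFun_bijective {m n p : ℕ} (h : m + n = p + 1) (a : Fin m) :
    Function.Bijective (insertFun h a) := by
  rw [Fintype.bijective_iff_injective_and_card]
  constructor
  · rintro (⟨x, hx⟩ | y) (⟨x', hx'⟩ | y') e
    · have h1 : x.1 ≠ a.1 := fun e => hx (Fin.ext e)
      have h2 : x'.1 ≠ a.1 := fun e => hx' (Fin.ext e)
      simp only [insertFun] at e
      congr 2
      split_ifs at e <;> simp only [Fin.mk.injEq] at e <;> apply Fin.ext <;> omega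
    · have h1 : x.1 ≠ a.1 := fun e => hx (Fin.ext e)
      simp only [insertFun] at e
      split_ifs at e <;> simp only [Fin.mk.injEq] at e <;> omega
    · have h2 : x'.1 ≠ a.1 := fun e => hx' (Fin.ext e)
      simp only [insertFun] at e
      split_ifs at e <;> simp only [Fin.mk.injEq] at e <;> omega
    · simp only [insertFun, Fin.mk.injEq] at e
      congr 1
      apply Fin.ext
      omega
  · have := a.2
    simp only [Fintype.card_sum, Fintype.card_subtype_compl, Fintype.card_fin,
      Fintype.card_unique]
    omega

/-- The bijection between the inputs of `f` other than `a` together with the inputs of `g`, and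
the inputs of `f ∘ₐ g`. -/
noncomputable def insertEquiv {m n p : ℕ} (h : m + n = p + 1) (a : Fin m) :
    {x : Fin m // x ≠ a} ⊕ Fin n ≃ Fin p :=
  Equiv.ofBijective (insertFun h a) (insertFun_bijective h a)

/-- The permutation `σ ∘ₐ τ` of the inputs of `f ∘ₐ g` induced by a permutation `σ` of the inputs
of `f` and a permutation `τ` of the inputs of `g`. -/
noncomputable def blockPerm {m n p : ℕ} (h : m + n = p + 1) (a : Fin m)
    (σ : Equiv.Perm (Fin m)) (τ : Equiv.Perm (Fin n)) : Equiv.Perm (Fin p) :=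
  (insertEquiv h a).symm.trans
    ((Equiv.sumCongr (σ.subtypeEquiv (p := fun x => x ≠ a) (q := fun x => x ≠ σ a)
    fun _ => σ.injective.ne_iff.symm) τ).trans
      (insertEquiv h (σ a)))

/-! ### Operads in graded vector spaces -/

/-- A (symmetric, unital) operad in `ℤ`-graded vector spaces over `k`, with arities `n ≥ 0`,
given by partial compositions. The degree `i` part of the arity `n` component is `X n i`.

The action is a left action: the input `x` of `f` is the input `σ x` of `act σ f` (so that the
usual right action is `f · σ = act σ⁻¹ f`). The composition `f ∘ₐ g` of `f` of arity `m` and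
degree `i` with `g` of arity `n` and degree `j` is `comp hp hd a f g`; its arity
`p = m + n - 1` and its degree `l = i + j` are specified by the equations `hp` and `hd`. -/
structure GradedOperad (k : Type u) [Field k] where
  X : ℕ → ℤ → Type v
  [addCommGroup : ∀ n i, AddCommGroup (X n i)]
  [module : ∀ n i, Module k (X n i)]
  act : ∀ {n : ℕ} {i : ℤ}, Equiv.Perm (Fin n) → X n i →ₗ[k] X n i
  act_one : ∀ {n : ℕ} {i : ℤ} (x : X n i), act 1 x = x
  act_mul : ∀ {n : ℕ} {i : ℤ} (σ τ : Equiv.Perm (Fin n)) (x : X n i),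
    act (σ * τ) x = act σ (act τ x)
  one : X 1 0
  comp : ∀ {m n p : ℕ} {i j l : ℤ}, m + n = p + 1 → i + j = l → Fin m →
    X m i →ₗ[k] X n j →ₗ[k] X p l
  one_comp : ∀ {n : ℕ} {j : ℤ} (hp : 1 + n = n + 1) (hd : 0 + j = j) (a : Fin 1) (g : X n j),
    comp hp hd a one g = g
  comp_one : ∀ {m : ℕ} {i : ℤ} (hp : m + 1 = m + 1) (hd : i + 0 = i) (a : Fin m) (f : X m i),
    comp hp hd a f one = f
  /-- Sequential associativity: `(f ∘ₐ g) ∘_{a+b} h = f ∘ₐ (g ∘_b h)`. -/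
  comp_assoc : ∀ {m n r p q s : ℕ} {i j l ij jl t : ℤ}
    (hp : m + n = p + 1) (hs : p + r = s + 1) (hq : n + r = q + 1) (hs' : m + q = s + 1)
    (hij : i + j = ij) (ht : ij + l = t) (hjl : j + l = jl) (ht' : i + jl = t)
    (a : Fin m) (b : Fin n) (c : Fin p) (_ : c.1 = a.1 + b.1)
    (f : X m i) (g : X n j) (h : X r l),
    comp hs ht c (comp hp hij a f g) h = comp hs' ht' a f (comp hq hjl b g h)
  /-- Parallel associativity: `(f ∘ₐ g) ∘_{b+n-1} h = (-1)^{|g||h|} (f ∘_b h) ∘ₐ g` for `a < b`,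
  where `n` is the arity of `g`. -/
  comp_comm : ∀ {m n r p q s : ℕ} {i j l ij il t : ℤ}
    (hp : m + n = p + 1) (hs : p + r = s + 1) (hq : m + r = q + 1) (hs' : q + n = s + 1)
    (hij : i + j = ij) (ht : ij + l = t) (hil : i + l = il) (ht' : il + j = t)
    (a b : Fin m) (_ : a < b) (b' : Fin p) (_ : b'.1 + 1 = b.1 + n)
    (a' : Fin q) (_ : a'.1 = a.1)
    (f : X m i) (g : X n j) (h : X r l),
    comp hs ht b' (comp hp hij a f g) h =
      (j * l).negOnePow • comp hs' ht' a' (comp hq hil b f h) g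
  comp_act : ∀ {m n p : ℕ} {i j l : ℤ} (hp : m + n = p + 1) (hd : i + j = l) (a : Fin m)
    (σ : Equiv.Perm (Fin m)) (τ : Equiv.Perm (Fin n)) (f : X m i) (g : X n j),
    comp hp hd (σ a) (act σ f) (act τ g) = act (blockPerm hp a σ τ) (comp hp hd a f g)

attribute [instance] GradedOperad.addCommGroup GradedOperad.module

variable {k : Type u} [Field k]

namespace GradedOperad

/-- Morphisms of operads in graded vector spaces (of degree zero). -/
@[ext]
structure Hom (P Q : GradedOperad.{v} k) where
  map : ∀ n i, P.X n i →ₗ[k] Q.X n i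
  map_act : ∀ {n : ℕ} {i : ℤ} (σ : Equiv.Perm (Fin n)) (x : P.X n i),
    map n i (P.act σ x) = Q.act σ (map n i x)
  map_one : map 1 0 P.one = Q.one
  map_comp : ∀ {m n p : ℕ} {i j l : ℤ} (hp : m + n = p + 1) (hd : i + j = l) (a : Fin m)
    (f : P.X m i) (g : P.X n j),
    map p l (P.comp hp hd a f g) = Q.comp hp hd a (map m i f) (map n j g)

instance : Category (GradedOperad.{v} k) where
  Hom P Q := Hom P Q
  id P :=
    { map := fun _ _ => LinearMap.id
      map_act := fun _ _ => rfl
      map_one := rfl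
      map_comp := fun _ _ _ _ _ => rfl }
  comp f g :=
    { map := fun n i => g.map n i ∘ₗ f.map n i
      map_act := fun σ x => by simp [f.map_act, g.map_act]
      map_one := by simp [f.map_one, g.map_one]
      map_comp := fun hp hd a x y => by simp [f.map_comp, g.map_comp] }

/-- The endomorphism of an operad in graded vector spaces that is multiplication by `q ^ i` in
degree `i`. -/
def gradingHom (P : GradedOperad.{v} k) (q : kˣ) : P ⟶ P :=
  Hom.mk
    (fun _ i => ((q ^ i : kˣ) : k) • LinearMap.id)
    (fun σ x => by simp)
    (by simp)
    (fun hp hd a f g => by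
      subst hd
      simp [zpow_add, smul_smul, mul_comm])

/-- The grading automorphism `φ_q` of an operad in graded vector spaces: multiplication by
`q ^ i` in degree `i`. -/
def gradingAut (P : GradedOperad.{v} k) (q : kˣ) : P ≅ P where
  hom := P.gradingHom q
  inv := P.gradingHom q⁻¹
  hom_inv_id := by
    apply Hom.ext
    funext n i
    ext x
    change ((q⁻¹ ^ i : kˣ) : k) • (((q ^ i : kˣ) : k) • x) = x
    rw [smul_smul, ← Units.val_mul, ← mul_zpow]
    simp
  inv_hom_id := by
    apply Hom.ext
    funext n i
    ext x
    change ((q ^ i : kˣ) : k) • (((q⁻¹ ^ i : kˣ) : k) • x) = x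
    rw [smul_smul, ← Units.val_mul, ← mul_zpow]
    simp

end GradedOperad

/-! ### Dg operads -/

/-- A dg operad over `k`, cohomologically graded: an operad in graded vector spaces with a
differential of degree `+1` that is compatible with all the structure. -/
structure DGOperad (k : Type u) [Field k] extends GradedOperad.{v} k where
  d : ∀ {n : ℕ} {i j : ℤ}, i + 1 = j → X n i →ₗ[k] X n j
  d_d : ∀ {n : ℕ} {i j l : ℤ} (h : i + 1 = j) (h' : j + 1 = l) (x : X n i), d h' (d h x) = 0
  d_act : ∀ {n : ℕ} {i j : ℤ} (h : i + 1 = j) (σ : Equiv.Perm (Fin n)) (x : X n i),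
    d h (act σ x) = act σ (d h x)
  d_one : ∀ {j : ℤ} (h : 0 + 1 = j), d h one = 0
  /-- The Leibniz rule `d (f ∘ₐ g) = d f ∘ₐ g + (-1)^{|f|} f ∘ₐ d g`. -/
  d_comp : ∀ {m n p : ℕ} {i i' j j' l l' : ℤ} (hp : m + n = p + 1) (hd : i + j = l)
    (hi : i + 1 = i') (hj : j + 1 = j') (hl : l + 1 = l') (h₁ : i' + j = l') (h₂ : i + j' = l')
    (a : Fin m) (f : X m i) (g : X n j),
    d hl (comp hp hd a f g) =
      comp hp h₁ a (d hi f) g + i.negOnePow • comp hp h₂ a f (d hj g)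

namespace DGOperad

/-- Morphisms of dg operads. -/
@[ext]
structure Hom (P Q : DGOperad.{v} k) extends
    GradedOperad.Hom P.toGradedOperad Q.toGradedOperad where
  map_d : ∀ {n : ℕ} {i j : ℤ} (h : i + 1 = j) (x : P.X n i),
    map n j (P.d h x) = Q.d h (map n i x)

instance : Category (DGOperad.{v} k) where
  Hom P Q := Hom P Q
  id P :=
    { map := fun _ _ => LinearMap.id
      map_act := fun _ _ => rfl
      map_one := rfl
      map_comp := fun _ _ _ _ _ => rfl
      map_d := fun _ _ => rfl }
  comp f g :=
    { map := fun n i => g.map n i ∘ₗ f.map n i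
      map_act := fun σ x => by simp [f.map_act, g.map_act]
      map_one := by simp [f.map_one, g.map_one]
      map_comp := fun hp hd a x y => by simp [f.map_comp, g.map_comp]
      map_d := fun h x => by simp [f.map_d, g.map_d] }

/-! ### The homology operad -/

section Homology

variable (P : DGOperad.{v} k)

/-- Cocycles of degree `i` in arity `n`. -/
def cycles (n : ℕ) (i : ℤ) : Submodule k (P.X n i) :=
  LinearMap.ker (P.d (n := n) (i := i) rfl)

/-- Coboundaries of degree `i` in arity `n`. -/
def boundaries (n : ℕ) (i : ℤ) : Submodule k (P.X n i) :=
  LinearMap.range (P.d (n := n) (sub_add_cancel i 1))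

variable {P}

theorem mem_cycles {n : ℕ} {i j : ℤ} (h : i + 1 = j) {x : P.X n i} :
    x ∈ P.cycles n i ↔ P.d h x = 0 := by
  subst h; rfl

theorem mem_boundaries {n : ℕ} {i j : ℤ} (h : j + 1 = i) {x : P.X n i} :
    x ∈ P.boundaries n i ↔ ∃ y : P.X n j, P.d h y = x := by
  obtain rfl : j = i - 1 := by omega
  rfl

theorem d_mem_boundaries {n : ℕ} {i j : ℤ} (h : j + 1 = i) (y : P.X n j) :
    P.d h y ∈ P.boundaries n i := (mem_boundaries h).2 ⟨y, rfl⟩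

theorem act_mem_cycles {n : ℕ} {i : ℤ} (σ : Equiv.Perm (Fin n)) {x : P.X n i}
    (hx : x ∈ P.cycles n i) : P.act σ x ∈ P.cycles n i := by
  rw [mem_cycles rfl] at hx ⊢
  rw [P.d_act, hx, map_zero]

theorem act_mem_boundaries {n : ℕ} {i : ℤ} (σ : Equiv.Perm (Fin n)) {x : P.X n i}
    (hx : x ∈ P.boundaries n i) : P.act σ x ∈ P.boundaries n i := by
  obtain ⟨y, rfl⟩ := hx
  rw [← P.d_act]
  exact d_mem_boundaries _ _

theorem comp_mem_cycles {m n p : ℕ} {i j l : ℤ} (hp : m + n = p + 1) (hd : i + j = l) (a : Fin m)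
    {f : P.X m i} {g : P.X n j} (hf : f ∈ P.cycles m i) (hg : g ∈ P.cycles n j) :
    P.comp hp hd a f g ∈ P.cycles p l := by
  rw [mem_cycles rfl] at hf hg ⊢
  rw [P.d_comp hp hd rfl rfl rfl (by omega) (by omega), hf, hg]
  simp

theorem comp_mem_boundaries_left {m n p : ℕ} {i j l : ℤ} (hp : m + n = p + 1) (hd : i + j = l)
    (a : Fin m) {f : P.X m i} {g : P.X n j} (hf : f ∈ P.boundaries m i)
    (hg : g ∈ P.cycles n j) : P.comp hp hd a f g ∈ P.boundaries p l := by
  obtain ⟨y, rfl⟩ := hf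
  rw [mem_cycles rfl] at hg
  have := P.d_comp hp (i := i - 1) (j := j) (l := l - 1) (by omega) (sub_add_cancel i 1) rfl
    (sub_add_cancel l 1) hd (by omega) a y g
  rw [hg, map_zero, smul_zero, add_zero] at this
  rw [← this]
  exact d_mem_boundaries _ _

theorem comp_mem_boundaries_right {m n p : ℕ} {i j l : ℤ} (hp : m + n = p + 1) (hd : i + j = l)
    (a : Fin m) {f : P.X m i} {g : P.X n j} (hf : f ∈ P.cycles m i)
    (hg : g ∈ P.boundaries n j) : P.comp hp hd a f g ∈ P.boundaries p l := by
  obtain ⟨y, rfl⟩ := hg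
  rw [mem_cycles rfl] at hf
  have := P.d_comp hp (i := i) (j := j - 1) (l := l - 1) (by omega) rfl (sub_add_cancel j 1)
    (sub_add_cancel l 1) (by omega) hd a f y
  rw [hf, map_zero, LinearMap.zero_apply, zero_add] at this
  have h2 : P.comp hp hd a f (P.d (sub_add_cancel j 1) y) =
      i.negOnePow • P.d (sub_add_cancel l 1)
        (P.comp (l := l - 1) hp (by omega) a f y) := by
    rw [this, smul_smul, ← Int.negOnePow_add, Int.negOnePow_even _ ⟨i, rfl⟩, one_smul]
  rw [h2, Units.smul_def]
  exact zsmul_mem (d_mem_boundaries _ _) _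

variable (P)

/-- The cohomology of degree `i` in arity `n`: cocycles modulo coboundaries. -/
abbrev H (n : ℕ) (i : ℤ) : Type v :=
  P.cycles n i ⧸ (P.boundaries n i).submoduleOf (P.cycles n i)

variable {P}

/-- The class of a cocycle. -/
abbrev H.mk {n : ℕ} {i : ℤ} : P.cycles n i →ₗ[k] P.H n i :=
  ((P.boundaries n i).submoduleOf (P.cycles n i)).mkQ

theorem H.ind {n : ℕ} {i : ℤ} {motive : P.H n i → Prop}
    (h : ∀ x : P.cycles n i, motive (H.mk x)) (x : P.H n i) : motive x :=
  (Submodule.mkQ_surjective _ x).elim fun y hy => hy ▸ h y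

variable (P)

/-- The action of the symmetric group on cohomology. -/
def actH {n : ℕ} {i : ℤ} (σ : Equiv.Perm (Fin n)) : P.H n i →ₗ[k] P.H n i :=
  Submodule.mapQ _ _ ((P.act σ).restrict fun _ hx => act_mem_cycles σ hx)
    fun _ hx => act_mem_boundaries σ hx

/-- Partial composition of cocycles. -/
def compCycles {m n p : ℕ} {i j l : ℤ} (hp : m + n = p + 1) (hd : i + j = l) (a : Fin m) :
    P.cycles m i →ₗ[k] P.cycles n j →ₗ[k] P.cycles p l :=
  LinearMap.mk₂ k (fun f g => ⟨P.comp hp hd a f.1 g.1, comp_mem_cycles hp hd a f.2 g.2⟩)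
    (fun _ _ _ => Subtype.ext (by simp)) (fun _ _ _ => Subtype.ext (by simp))
    (fun _ _ _ => Subtype.ext (by simp)) (fun _ _ _ => Subtype.ext (by simp))

/-- Partial composition of cohomology classes. -/
def compH {m n p : ℕ} {i j l : ℤ} (hp : m + n = p + 1) (hd : i + j = l) (a : Fin m) :
    P.H m i →ₗ[k] P.H n j →ₗ[k] P.H p l :=
  Submodule.liftQ _
    (LinearMap.flip (Submodule.liftQ _ (LinearMap.flip ((P.compCycles hp hd a).compr₂ H.mk))
      (fun g hg => by
        rw [LinearMap.mem_ker]
        ext f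
        exact (Submodule.Quotient.mk_eq_zero _).2 (comp_mem_boundaries_right hp hd a f.2 hg))))
    (fun f hf => by
      rw [LinearMap.mem_ker]
      ext g
      exact (Submodule.Quotient.mk_eq_zero _).2 (comp_mem_boundaries_left hp hd a hf g.2))

theorem actH_mk {n : ℕ} {i : ℤ} (σ : Equiv.Perm (Fin n)) (x : P.cycles n i) :
    P.actH σ (H.mk x) = H.mk ⟨P.act σ x.1, act_mem_cycles σ x.2⟩ := rfl

theorem compH_mk {m n p : ℕ} {i j l : ℤ} (hp : m + n = p + 1) (hd : i + j = l) (a : Fin m)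
    (f : P.cycles m i) (g : P.cycles n j) :
    P.compH hp hd a (H.mk f) (H.mk g) =
      H.mk ⟨P.comp hp hd a f.1 g.1, comp_mem_cycles hp hd a f.2 g.2⟩ := rfl

/-- The cohomology operad `H(P)` of a dg operad `P`. -/
def homology : GradedOperad.{v} k where
  X n i := P.H n i
  act σ := P.actH σ
  act_one x := by
    induction x using H.ind with | h x =>
    rw [actH_mk]
    exact congrArg _ (Subtype.ext (P.act_one _))
  act_mul σ τ x := by
    induction x using H.ind with | h x =>
    rw [actH_mk, actH_mk, actH_mk]
    exact congrArg _ (Subtype.ext (P.act_mul _ _ _))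
  one := H.mk ⟨P.one, P.d_one _⟩
  comp hp hd a := P.compH hp hd a
  one_comp hp hd a g := by
    induction g using H.ind with | h g =>
    rw [compH_mk]
    exact congrArg _ (Subtype.ext (P.one_comp _ _ _ _))
  comp_one hp hd a f := by
    induction f using H.ind with | h f =>
    rw [compH_mk]
    exact congrArg _ (Subtype.ext (P.comp_one _ _ _ _))
  comp_assoc hp hs hq hs' hij ht hjl ht' a b c hc f g h := by
    induction f using H.ind with | h f =>
    induction g using H.ind with | h g =>
    induction h using H.ind with | h h =>
    rw [compH_mk, compH_mk, compH_mk, compH_mk]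
    exact congrArg _ (Subtype.ext (P.comp_assoc hp hs hq hs' hij ht hjl ht' a b c hc _ _ _))
  comp_comm hp hs hq hs' hij ht hil ht' a b hab b' hb' a' ha' f g h := by
    induction f using H.ind with | h f =>
    induction g using H.ind with | h g =>
    induction h using H.ind with | h h =>
    rw [compH_mk, compH_mk, compH_mk, compH_mk, Units.smul_def, ← map_zsmul]
    refine congrArg _ (Subtype.ext ?_)
    exact P.comp_comm hp hs hq hs' hij ht hil ht' a b hab b' hb' a' ha' _ _ _
  comp_act hp hd a σ τ f g := by
    induction f using H.ind with | h f =>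
    induction g using H.ind with | h g =>
    rw [actH_mk, actH_mk, compH_mk, compH_mk, actH_mk]
    exact congrArg _ (Subtype.ext (P.comp_act _ _ _ _ _ _ _))

end Homology

/-- The cohomology functor from dg operads to operads in graded vector spaces. -/
def homologyFunctor (k : Type u) [Field k] : DGOperad.{v} k ⥤ GradedOperad.{v} k where
  obj P := P.homology
  map {P Q} f := GradedOperad.Hom.mk
    (fun n i => Submodule.mapQ _ _
      (((Hom.toHom f).map n i).restrict fun x hx => by
        rw [mem_cycles rfl] at hx ⊢
        rw [← Hom.map_d f, hx, map_zero])
      (fun x hx => by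
        obtain ⟨y, hy⟩ := hx
        refine ⟨(Hom.toHom f).map n _ y, ?_⟩
        rw [← Hom.map_d f, hy]
        rfl))
    (fun σ x => by
      induction x using H.ind with | h x =>
      exact congrArg H.mk (Subtype.ext ((Hom.toHom f).map_act σ x.1)))
    (congrArg H.mk (Subtype.ext (Hom.toHom f).map_one))
    (fun hp hd a x y => by
      induction x using H.ind with | h x =>
      induction y using H.ind with | h y =>
      exact congrArg H.mk (Subtype.ext ((Hom.toHom f).map_comp hp hd a x.1 y.1)))
  map_id P := by
    apply GradedOperad.Hom.ext
    funext n i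
    refine LinearMap.ext fun x => ?_
    induction x using H.ind with | h x => rfl
  map_comp f g := by
    apply GradedOperad.Hom.ext
    funext n i
    refine LinearMap.ext fun x => ?_
    induction x using H.ind with | h x => rfl

/-- A morphism of dg operads is a quasi-isomorphism if it induces an isomorphism on cohomology
in every arity and every degree. -/
def QuasiIso {P Q : DGOperad.{v} k} (f : P ⟶ Q) : Prop :=
  ∀ (n : ℕ) (i : ℤ), Function.Bijective (GradedOperad.Hom.map ((homologyFunctor k).map f) n i)

end DGOperad

/-- An operad in graded vector spaces, viewed as a dg operad with zero differential. -/
def GradedOperad.toDGOperad (P : GradedOperad.{v} k) : DGOperad.{v} k where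
  toGradedOperad := P
  d _ := 0
  d_d _ _ _ := rfl
  d_act _ _ _ := by simp
  d_one _ := rfl
  d_comp _ _ _ _ _ _ _ _ _ _ := by simp

/-- A dg operad `P` is formal if it is connected to its cohomology `H(P)`, with zero differential,
by a (finite) chain of quasi-isomorphisms of dg operads, pointing in either direction. -/
def DGOperad.Formal (P : DGOperad.{v} k) : Prop :=
  Relation.EqvGen (fun Q R : DGOperad.{v} k => ∃ f : Q ⟶ R, DGOperad.QuasiIso f)
    P P.homology.toDGOperad

end Operadic

/-!
Since `σ` acts on `H(P)` in degree `i` by `q ^ i`, and the powers of `q` are distinct, `P` should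
split up to homotopy into eigenspaces of `σ`, each with its cohomology in a single degree. Strict
eigenspaces need not exist in `P`, so they are replaced by homotopy eigenspaces: in weight `w`, the
paths `γ` in `P ⊗ k[s, ds]` with `σ γ(0) = q ^ w γ(1)`. These are compatible with the operad
structure, weights being additive under composition. As `σ - q ^ w` is invertible on `H^i(P)` for
`i ≠ w`, the cohomology of the homotopy eigenspace of weight `w` is `H^w(P)` in degree `w`, together
with a copy of `H^w(P)` in degree `w + 1`, which the truncation to degrees at most `w` removes.

Let `W` be the direct sum over all weights of the truncated homotopy eigenspaces. Evaluation at
`s = 0` is a quasi-isomorphism `W ⟶ P`. In degree `i` the weights smaller than `i` vanish and the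
weight `i` part consists of cocycles, so the class of `γ(0)`, where `γ` is the component of weight
`i`, is a morphism `W ⟶ H(P)`, which is a quasi-isomorphism as well.
-/

namespace Operadic

section Convolution

variable {R M X Y Z X' Y' Z' W : Type*} [CommSemiring R]
  [AddCommMonoid X] [AddCommMonoid Y] [AddCommMonoid Z] [AddCommMonoid X'] [AddCommMonoid Y']
  [AddCommMonoid Z'] [AddCommMonoid W] [Module R X] [Module R Y] [Module R Z] [Module R X']
  [Module R Y'] [Module R Z'] [Module R W]

section AddCommMonoid

variable [AddCommMonoid M]

/-- The extension `(x tᵐ, y tᵐ') ↦ B(x, y) tᵐ⁺ᵐ'` of a bilinear map `B` to polynomials with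
exponents in `M` and coefficients in modules, which are encoded as finitely supported functions
on `M`. -/
noncomputable def convolution (B : X →ₗ[R] Y →ₗ[R] Z) :
    (M →₀ X) →ₗ[R] (M →₀ Y) →ₗ[R] (M →₀ Z) :=
  Finsupp.lsum R fun m => LinearMap.flip (Finsupp.lsum R fun m' =>
    LinearMap.flip (B.compr₂ (Finsupp.lsingle (m + m'))))

@[simp]
theorem convolution_single_single (B : X →ₗ[R] Y →ₗ[R] Z) (m m' : M) (x : X) (y : Y) :
    convolution B (Finsupp.single m x) (Finsupp.single m' y) =
      Finsupp.single (m + m') (B x y) := by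
  simp [convolution]

theorem convolution_single_zero_left (B : X →ₗ[R] Y →ₗ[R] Z) (x : X) (g : M →₀ Y) :
    convolution B (Finsupp.single 0 x) g = Finsupp.mapRange.linearMap (B x) g := by
  induction g using Finsupp.induction_linear with
  | zero => simp only [map_zero]
  | add g e hg he => simp only [map_add, hg, he]
  | single m y => simp

theorem convolution_single_zero_right (B : X →ₗ[R] Y →ₗ[R] Z) (f : M →₀ X) (y : Y) :
    convolution B f (Finsupp.single 0 y) = Finsupp.mapRange.linearMap (B.flip y) f := by
  induction f using Finsupp.induction_linear with
  | zero => simp only [map_zero, LinearMap.zero_apply]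
  | add f g hf hg => simp only [map_add, LinearMap.add_apply, hf, hg]
  | single m x => simp

theorem convolution_assoc {B₁ : X →ₗ[R] Y →ₗ[R] Z} {B₂ : Z →ₗ[R] X' →ₗ[R] W}
    {B₃ : Y →ₗ[R] X' →ₗ[R] Z'} {B₄ : X →ₗ[R] Z' →ₗ[R] W}
    (h : ∀ x y z, B₂ (B₁ x y) z = B₄ x (B₃ y z)) (f : M →₀ X) (g : M →₀ Y) (e : M →₀ X') :
    convolution B₂ (convolution B₁ f g) e = convolution B₄ f (convolution B₃ g e) := by
  have key : (convolution (M := M) B₁).compr₂ (convolution B₂) =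
      (LinearMap.llcomp R (M →₀ X') (M →₀ Z') (M →₀ W)).compl₁₂
        (convolution B₄) (convolution B₃) := by
    ext m x m' y m'' z : 9
    simp [h, add_assoc]
  exact congr($key f g e)

theorem convolution_right_comm {G : Type*} [Monoid G] [DistribMulAction G W] [SMulCommClass R G W]
    {B₁ : X →ₗ[R] Y →ₗ[R] Z} {B₂ : Z →ₗ[R] X' →ₗ[R] W} {B₃ : X →ₗ[R] X' →ₗ[R] Z'}
    {B₄ : Z' →ₗ[R] Y →ₗ[R] W} {c : G} (h : ∀ x y z, B₂ (B₁ x y) z = c • B₄ (B₃ x z) y)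
    (f : M →₀ X) (g : M →₀ Y) (e : M →₀ X') :
    convolution B₂ (convolution B₁ f g) e = c • convolution B₄ (convolution B₃ f e) g := by
  have key : (convolution (M := M) B₁).compr₂ (convolution B₂) =
      c • (LinearMap.llcomp R (M →₀ X') (M →₀ Z') (M →₀ W)).flip.compl₁₂ (convolution B₃)
        (convolution B₄).flip := by
    ext m x m' y m'' z : 9
    simp [h, add_right_comm]
  exact congr($key f g e)

theorem mapRange_convolution {L : Z →ₗ[R] Z'} {L₁ : X →ₗ[R] X'} {L₂ : Y →ₗ[R] Y'}
    {B : X →ₗ[R] Y →ₗ[R] Z} {B' : X' →ₗ[R] Y' →ₗ[R] Z'} (h : ∀ x y, L (B x y) = B' (L₁ x) (L₂ y))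
    (f : M →₀ X) (g : M →₀ Y) :
    Finsupp.mapRange.linearMap L (convolution B f g) =
      convolution B' (Finsupp.mapRange.linearMap L₁ f) (Finsupp.mapRange.linearMap L₂ g) := by
  have key : (convolution (M := M) B).compr₂ (Finsupp.mapRange.linearMap L) =
      (convolution B').compl₁₂ (Finsupp.mapRange.linearMap L₁) (Finsupp.mapRange.linearMap L₂) := by
    ext m x m' y : 6
    simp [h]
  exact congr($key f g)

theorem mapRange_convolution_of_leibniz {G : Type*} [Monoid G] [DistribMulAction G W]
    [SMulCommClass R G W] {c : G} {L : Z →ₗ[R] W} {L₁ : X →ₗ[R] X'} {L₂ : Y →ₗ[R] Y'}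
    {B : X →ₗ[R] Y →ₗ[R] Z} {B₁ : X' →ₗ[R] Y →ₗ[R] W} {B₂ : X →ₗ[R] Y' →ₗ[R] W}
    (h : ∀ x y, L (B x y) = B₁ (L₁ x) y + c • B₂ x (L₂ y)) (f : M →₀ X) (g : M →₀ Y) :
    Finsupp.mapRange.linearMap L (convolution B f g) =
      convolution B₁ (Finsupp.mapRange.linearMap L₁ f) g +
        c • convolution B₂ f (Finsupp.mapRange.linearMap L₂ g) := by
  have key : (convolution (M := M) B).compr₂ (Finsupp.mapRange.linearMap L) =
      (convolution B₁).comp (Finsupp.mapRange.linearMap L₁) +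
        c • (convolution B₂).compl₂ (Finsupp.mapRange.linearMap L₂) := by
    ext m x m' y : 6
    simp [h]
  exact congr($key f g)

theorem convolution_apply (B : X →ₗ[R] Y →ₗ[R] Z) (f : M →₀ X) (g : M →₀ Y) (m : M)
    [DecidableEq M] :
    convolution B f g m =
      ∑ a ∈ f.support, ∑ b ∈ g.support, if a + b = m then B (f a) (g b) else 0 := by
  simp [convolution, Finsupp.sum, Finsupp.single_apply]

theorem convolution_apply_mem (B : X →ₗ[R] Y →ₗ[R] Z) (S : M → Submodule R Z) {f : M →₀ X}
    {g : M →₀ Y} (h : ∀ m m', B (f m) (g m') ∈ S (m + m')) (m : M) :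
    convolution B f g m ∈ S m := by
  classical
  rw [convolution_apply]
  refine Submodule.sum_mem _ fun a _ => Submodule.sum_mem _ fun b _ => ?_
  split_ifs with hab
  · exact hab ▸ h a b
  · exact Submodule.zero_mem _

theorem convolution_apply_add_of_unique (B : X →ₗ[R] Y →ₗ[R] Z) {f : M →₀ X} {g : M →₀ Y}
    {a b : M} (h : ∀ m m', m + m' = a + b → B (f m) (g m') ≠ 0 → m = a ∧ m' = b) :
    convolution B f g (a + b) = B (f a) (g b) := by
  classical
  have off_diagonal (m m' : M) (hne : ¬(m = a ∧ m' = b)) :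
      (if m + m' = a + b then B (f m) (g m') else 0) = 0 :=
    ite_eq_right_iff.2 fun hadd => not_imp_comm.1 (h m m' hadd) hne
  rw [convolution_apply, Finset.sum_eq_single a, Finset.sum_eq_single b, if_pos rfl]
  · exact fun m' _ hm' => off_diagonal a m' fun e => hm' e.2
  · exact fun hb => by simp [Finsupp.notMem_support_iff.1 hb]
  · exact fun m _ hm => Finset.sum_eq_zero fun m' _ => off_diagonal m m' fun e => hm e.1
  · exact fun ha => by simp [Finsupp.notMem_support_iff.1 ha]

/-- The evaluation of polynomials with coefficients in a module at the point at which the monomial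
`tᵐ` takes the value `χ m`. -/
noncomputable def characterEval (χ : Multiplicative M →* R) : (M →₀ X) →ₗ[R] X :=
  Finsupp.lsum R fun m => χ (Multiplicative.ofAdd m) • LinearMap.id

@[simp]
theorem characterEval_single (χ : Multiplicative M →* R) (m : M) (x : X) :
    characterEval χ (Finsupp.single m x) = χ (Multiplicative.ofAdd m) • x := by
  simp [characterEval]

theorem characterEval_mapRange (χ : Multiplicative M →* R) (L : X →ₗ[R] Y) (f : M →₀ X) :
    characterEval χ (Finsupp.mapRange.linearMap L f) = L (characterEval χ f) := by
  induction f using Finsupp.induction_linear with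
  | zero => simp only [map_zero]
  | add f g hf hg => simp only [map_add, hf, hg]
  | single m x => simp

theorem characterEval_convolution (χ : Multiplicative M →* R) (B : X →ₗ[R] Y →ₗ[R] Z)
    (f : M →₀ X) (g : M →₀ Y) :
    characterEval χ (convolution B f g) = B (characterEval χ f) (characterEval χ g) := by
  have key : (convolution B).compr₂ (characterEval χ) =
      B.compl₁₂ (characterEval χ) (characterEval χ) := by
    ext m x m' y : 6
    simp [smul_smul, mul_comm]
  exact congr($key f g)

end AddCommMonoid

/-- The evaluation of polynomials with coefficients in a module at a scalar. -/
noncomputable abbrev evalAt (c : R) : (ℕ →₀ X) →ₗ[R] X :=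
  characterEval (powersHom R c)

/-- The derivative of polynomials with coefficients in a module. -/
noncomputable def formalDeriv : (ℕ →₀ X) →ₗ[R] (ℕ →₀ X) :=
  Finsupp.lsum R fun m => (m : R) • Finsupp.lsingle (m - 1)

@[simp]
theorem formalDeriv_single (m : ℕ) (x : X) :
    formalDeriv (R := R) (Finsupp.single m x) = Finsupp.single (m - 1) ((m : R) • x) := by
  simp [formalDeriv]

theorem formalDeriv_mapRange (L : X →ₗ[R] Y) (f : ℕ →₀ X) :
    formalDeriv (R := R) (Finsupp.mapRange.linearMap L f) =
      Finsupp.mapRange.linearMap L (formalDeriv (R := R) f) := by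
  induction f using Finsupp.induction_linear with
  | zero => simp only [map_zero]
  | add f g hf hg => simp only [map_add, hf, hg]
  | single m x => simp

theorem formalDeriv_convolution (B : X →ₗ[R] Y →ₗ[R] Z) (f : ℕ →₀ X) (g : ℕ →₀ Y) :
    formalDeriv (R := R) (convolution B f g) =
      convolution B (formalDeriv (R := R) f) g + convolution B f (formalDeriv (R := R) g) := by
  have key : (convolution (M := ℕ) B).compr₂ (formalDeriv (R := R)) =
      (convolution B).comp (formalDeriv (R := R)) +
        (convolution B).compl₂ (formalDeriv (R := R)) := by
    ext m x m' y : 6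
    rcases m with _ | m <;> rcases m' with _ | m'
    · simp
    · simp
    · simp
    · have add_succ : m + (m' + 1) = m + 1 + m' := by omega
      simp [add_succ, ← add_assoc, ← Finsupp.single_add, ← add_smul]
  exact congr($key f g)

end Convolution

section FormalIntegral

variable {K X Y : Type*} [Field K] [AddCommMonoid X] [AddCommMonoid Y] [Module K X] [Module K Y]

/-- The integral with zero constant term of polynomials with coefficients in a vector space. -/
noncomputable def formalIntegral : (ℕ →₀ X) →ₗ[K] (ℕ →₀ X) :=
  Finsupp.lsum K fun m => ((m : K) + 1)⁻¹ • Finsupp.lsingle (m + 1)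

@[simp]
theorem formalIntegral_single (m : ℕ) (x : X) :
    formalIntegral (K := K) (Finsupp.single m x) =
      Finsupp.single (m + 1) (((m : K) + 1)⁻¹ • x) := by
  simp [formalIntegral]

theorem formalIntegral_mapRange (L : X →ₗ[K] Y) (f : ℕ →₀ X) :
    formalIntegral (K := K) (Finsupp.mapRange.linearMap L f) =
      Finsupp.mapRange.linearMap L (formalIntegral (K := K) f) := by
  induction f using Finsupp.induction_linear with
  | zero => simp only [map_zero]
  | add f g hf hg => simp only [map_add, hf, hg]
  | single m x => simp

theorem evalAt_zero_formalIntegral (f : ℕ →₀ X) :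
    evalAt (0 : K) (formalIntegral (K := K) f) = 0 := by
  induction f using Finsupp.induction_linear <;> simp_all

variable [CharZero K]

theorem formalDeriv_formalIntegral (f : ℕ →₀ X) :
    formalDeriv (R := K) (formalIntegral (K := K) f) = f := by
  induction f using Finsupp.induction_linear with
  | zero => simp
  | add f g hf hg => simp only [map_add, hf, hg]
  | single m x => simp [smul_smul, Nat.cast_add_one_ne_zero m]

theorem formalIntegral_formalDeriv_add (f : ℕ →₀ X) :
    formalIntegral (K := K) (formalDeriv (R := K) f) +
      Finsupp.single 0 (evalAt (0 : K) f) = f := by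
  induction f using Finsupp.induction_linear with
  | zero => simp
  | add f g hf hg =>
    conv_rhs => rw [← hf, ← hg]
    simp only [map_add, Finsupp.single_add]
    abel
  | single m x =>
    rcases m with _ | m
    · simp
    · simp [smul_smul, Nat.cast_add_one_ne_zero m]

end FormalIntegral

variable {k : Type u} [Field k]

/-- The operad `P ⊗ k[M]` of polynomials with coefficients in `P` and exponents in `M`. -/
noncomputable def GradedOperad.polynomial (P : GradedOperad.{v} k) (M : Type) [AddCommMonoid M] :
    GradedOperad.{v} k where
  X n i := M →₀ P.X n i
  act σ := Finsupp.mapRange.linearMap (P.act σ)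
  act_one _ := Finsupp.ext fun _ => P.act_one _
  act_mul σ τ _ := Finsupp.ext fun _ => P.act_mul σ τ _
  one := Finsupp.single 0 P.one
  comp hp hd a := convolution (P.comp hp hd a)
  one_comp hp hd a g :=
    (convolution_single_zero_left _ _ g).trans (Finsupp.ext fun _ => P.one_comp hp hd a _)
  comp_one hp hd a f :=
    (convolution_single_zero_right _ f _).trans (Finsupp.ext fun _ => P.comp_one hp hd a _)
  comp_assoc hp hs hq hs' hij ht hjl ht' a b c hc :=
    convolution_assoc (P.comp_assoc hp hs hq hs' hij ht hjl ht' a b c hc)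
  comp_comm hp hs hq hs' hij ht hil ht' a b hab b' hb' a' ha' :=
    convolution_right_comm (P.comp_comm hp hs hq hs' hij ht hil ht' a b hab b' hb' a' ha')
  comp_act hp hd a σ τ f g := (mapRange_convolution
    (fun x y => (P.comp_act hp hd a σ τ x y).symm) f g).symm

namespace DGOperad

/-- The dg operad `P ⊗ k[M]` of polynomials with coefficients in `P` and exponents in `M`, where
the variables are cocycles of degree zero. -/
noncomputable def polynomial (P : DGOperad.{v} k) (M : Type) [AddCommMonoid M] :
    DGOperad.{v} k where
  toGradedOperad := P.toGradedOperad.polynomial M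
  d h := Finsupp.mapRange.linearMap (P.d h)
  d_d h h' _ := Finsupp.ext fun _ => P.d_d h h' _
  d_act h σ _ := Finsupp.ext fun _ => P.d_act h σ _
  d_one h := (Finsupp.mapRange_single (hf := map_zero _)).trans
    (by rw [P.d_one h, Finsupp.single_zero]; rfl)
  d_comp hp hd hi hj hl h₁ h₂ a :=
    mapRange_convolution_of_leibniz (P.d_comp hp hd hi hj hl h₁ h₂ a)

/-- The evaluation at the point at which the monomial `tᵐ` takes the value `χ m`. -/
noncomputable def polynomialEval (P : DGOperad.{v} k) {M : Type} [AddCommMonoid M]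
    (χ : Multiplicative M →* k) : P.polynomial M ⟶ P :=
  Hom.mk
    { map := fun _ _ => characterEval χ
      map_act := fun σ x => characterEval_mapRange χ (P.act σ) x
      map_one := (characterEval_single χ 0 P.one).trans (by rw [ofAdd_zero, map_one, one_smul])
      map_comp := fun hp hd a x y => characterEval_convolution χ (P.comp hp hd a) x y }
    (fun h x => characterEval_mapRange χ (P.d h) x)

end DGOperad

namespace GradedOperad

variable (P : GradedOperad.{v} k)

/-- The partial composition of the operad `P ⊗ k[ε]`, where `ε` has degree one and `ε² = 0`; the
pair `(x, y)` encodes the operation `x + ε y`. -/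
noncomputable def dualNumbersComp {m n p : ℕ} {i j l : ℤ} (hp : m + n = p + 1) (hd : i + j = l)
    (a : Fin m) :
    P.X m i × P.X m (i - 1) →ₗ[k] P.X n j × P.X n (j - 1) →ₗ[k] P.X p l × P.X p (l - 1) :=
  LinearMap.mk₂ k
    (fun f g => (P.comp hp hd a f.1 g.1,
      P.comp hp (by omega) a f.2 g.1 + i.negOnePow • P.comp hp (by omega) a f.1 g.2))
    (fun _ _ _ => Prod.ext (by simp) (by simp; abel))
    (fun c _ _ => Prod.ext (by simp) (by simp [smul_comm _ c]))
    (fun _ _ _ => Prod.ext (by simp) (by simp; abel))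
    (fun c _ _ => Prod.ext (by simp) (by simp [smul_comm _ c]))

variable {P}

theorem dualNumbersComp_apply {m n p : ℕ} {i j l : ℤ} (hp : m + n = p + 1) (hd : i + j = l)
    (a : Fin m) (f : P.X m i × P.X m (i - 1)) (g : P.X n j × P.X n (j - 1)) :
    P.dualNumbersComp hp hd a f g = (P.comp hp hd a f.1 g.1,
      P.comp hp (by omega) a f.2 g.1 + i.negOnePow • P.comp hp (by omega) a f.1 g.2) :=
  rfl

theorem one_dualNumbersComp {n : ℕ} {j : ℤ} (hp : 1 + n = n + 1) (hd : 0 + j = j) (a : Fin 1)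
    (g : P.X n j × P.X n (j - 1)) : P.dualNumbersComp hp hd a (P.one, 0) g = g := by
  rw [dualNumbersComp_apply]
  simp [P.one_comp]

theorem dualNumbersComp_one {m : ℕ} {i : ℤ} (hp : m + 1 = m + 1) (hd : i + 0 = i) (a : Fin m)
    (f : P.X m i × P.X m (i - 1)) : P.dualNumbersComp hp hd a f (P.one, 0) = f := by
  rw [dualNumbersComp_apply]
  simp [P.comp_one]

theorem dualNumbersComp_act {m n p : ℕ} {i j l : ℤ} (hp : m + n = p + 1) (hd : i + j = l)
    (a : Fin m) (σ : Equiv.Perm (Fin m)) (τ : Equiv.Perm (Fin n)) (f : P.X m i × P.X m (i - 1))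
    (g : P.X n j × P.X n (j - 1)) :
    P.dualNumbersComp hp hd (σ a) ((P.act σ).prodMap (P.act σ) f) ((P.act τ).prodMap (P.act τ) g) =
      (P.act (blockPerm hp a σ τ)).prodMap (P.act (blockPerm hp a σ τ))
        (P.dualNumbersComp hp hd a f g) := by
  simp [dualNumbersComp_apply, P.comp_act]

theorem dualNumbersComp_assoc {m n r p q s : ℕ} {i j l ij jl t : ℤ}
    (hp : m + n = p + 1) (hs : p + r = s + 1) (hq : n + r = q + 1) (hs' : m + q = s + 1)
    (hij : i + j = ij) (ht : ij + l = t) (hjl : j + l = jl) (ht' : i + jl = t)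
    (a : Fin m) (b : Fin n) (c : Fin p) (hc : c.1 = a.1 + b.1)
    (f : P.X m i × P.X m (i - 1)) (g : P.X n j × P.X n (j - 1)) (h : P.X r l × P.X r (l - 1)) :
    P.dualNumbersComp hs ht c (P.dualNumbersComp hp hij a f g) h =
      P.dualNumbersComp hs' ht' a f (P.dualNumbersComp hq hjl b g h) := by
  refine Prod.ext (P.comp_assoc hp hs hq hs' hij ht hjl ht' a b c hc _ _ _) ?_
  simp only [dualNumbersComp_apply, map_add, LinearMap.add_apply, LinearMap.map_smul_of_tower,
    LinearMap.smul_apply, smul_add, smul_smul]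
  rw [P.comp_assoc hp hs hq hs' _ _ _ _ a b c hc, P.comp_assoc hp hs hq hs' _ _ _ _ a b c hc,
    P.comp_assoc hp hs hq hs' _ _ _ _ a b c hc, ← hij, Int.negOnePow_add, add_assoc]

theorem dualNumbersComp_comm {m n r p q s : ℕ} {i j l ij il t : ℤ}
    (hp : m + n = p + 1) (hs : p + r = s + 1) (hq : m + r = q + 1) (hs' : q + n = s + 1)
    (hij : i + j = ij) (ht : ij + l = t) (hil : i + l = il) (ht' : il + j = t)
    (a b : Fin m) (hab : a < b) (b' : Fin p) (hb' : b'.1 + 1 = b.1 + n)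
    (a' : Fin q) (ha' : a'.1 = a.1)
    (f : P.X m i × P.X m (i - 1)) (g : P.X n j × P.X n (j - 1)) (h : P.X r l × P.X r (l - 1)) :
    P.dualNumbersComp hs ht b' (P.dualNumbersComp hp hij a f g) h =
      (j * l).negOnePow • P.dualNumbersComp hs' ht' a' (P.dualNumbersComp hq hil b f h) g := by
  refine Prod.ext (P.comp_comm hp hs hq hs' hij ht hil ht' a b hab b' hb' a' ha' _ _ _) ?_
  have sign_g : i.negOnePow * ((j - 1) * l).negOnePow = (j * l).negOnePow * il.negOnePow := by
    rw [← Int.negOnePow_add, ← Int.negOnePow_add, Int.negOnePow_eq_iff]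
    exact ⟨-l, by rw [← hil]; ring⟩
  have sign_h : ij.negOnePow * (j * (l - 1)).negOnePow = (j * l).negOnePow * i.negOnePow := by
    rw [← Int.negOnePow_add, ← Int.negOnePow_add, ← hij]
    congr 1
    ring
  simp only [dualNumbersComp_apply, map_add, LinearMap.add_apply, LinearMap.map_smul_of_tower,
    LinearMap.smul_apply, smul_add, Prod.smul_snd]
  rw [P.comp_comm hp hs hq hs' _ _ (il := il - 1) (by omega) (by omega) a b hab b' hb' a' ha' f.2,
    P.comp_comm hp hs hq hs' _ _ hil (by omega) a b hab b' hb' a' ha' f.1 g.2,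
    P.comp_comm hp hs hq hs' _ _ (il := il - 1) (by omega) (by omega) a b hab b' hb' a' ha'
      f.1 g.1 h.2]
  simp only [smul_smul, sign_g, sign_h]
  abel

variable (P)

/-- The operad `P ⊗ k[ε]`, where `ε` has degree one and `ε² = 0`; the pair `(x, y)` encodes the
operation `x + ε y`. -/
noncomputable def dualNumbers : GradedOperad.{v} k where
  X n i := P.X n i × P.X n (i - 1)
  act σ := (P.act σ).prodMap (P.act σ)
  act_one _ := Prod.ext (P.act_one _) (P.act_one _)
  act_mul _ _ _ := Prod.ext (P.act_mul _ _ _) (P.act_mul _ _ _)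
  one := (P.one, 0)
  comp := P.dualNumbersComp
  one_comp := one_dualNumbersComp
  comp_one := dualNumbersComp_one
  comp_assoc := dualNumbersComp_assoc
  comp_comm := dualNumbersComp_comm
  comp_act := dualNumbersComp_act

end GradedOperad

namespace DGOperad

/-- A derivation of degree zero of a dg operad that commutes with the differential. The degree
`j` of the value on an operation of degree `i` is specified by an equation. -/
structure Derivation (P : DGOperad.{v} k) where
  map : ∀ {n : ℕ} {i j : ℤ}, i = j → P.X n i →ₗ[k] P.X n j
  map_act : ∀ {n : ℕ} {i j : ℤ} (h : i = j) (σ : Equiv.Perm (Fin n)) (x : P.X n i),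
    map h (P.act σ x) = P.act σ (map h x)
  map_one : ∀ {j : ℤ} (h : 0 = j), map h P.one = 0
  map_comp : ∀ {m n p : ℕ} {i j l i' j' l' : ℤ} (hp : m + n = p + 1) (hd : i + j = l)
    (hi : i = i') (hj : j = j') (hl : l = l') (h₁ : i' + j = l') (h₂ : i + j' = l') (a : Fin m)
    (f : P.X m i) (g : P.X n j),
    map hl (P.comp hp hd a f g) = P.comp hp h₁ a (map hi f) g + P.comp hp h₂ a f (map hj g)
  map_d : ∀ {n : ℕ} {i j i' j' : ℤ} (h : i + 1 = j) (hi : i = i') (hj : j = j') (h' : i' + 1 = j')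
    (x : P.X n i), map hj (P.d h x) = P.d h' (map hi x)

namespace Derivation

variable {P : DGOperad.{v} k} (D : P.Derivation)

/-- The differential `d (x + ε y) = d x + ε (D x - d y)` of the dg operad `D.extension`. -/
noncomputable def extensionDiff {n : ℕ} {i j : ℤ} (h : i + 1 = j) :
    P.X n i × P.X n (i - 1) →ₗ[k] P.X n j × P.X n (j - 1) :=
  (P.d h ∘ₗ LinearMap.fst k _ _).prod
    (D.map (by omega) ∘ₗ LinearMap.fst k _ _ - P.d (by omega) ∘ₗ LinearMap.snd k _ _)

theorem extensionDiff_apply {n : ℕ} {i j : ℤ} (h : i + 1 = j) (x : P.X n i × P.X n (i - 1)) :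
    D.extensionDiff h x = (P.d h x.1, D.map (by omega) x.1 - P.d (by omega) x.2) :=
  rfl

theorem extensionDiff_extensionDiff {n : ℕ} {i j l : ℤ} (h : i + 1 = j) (h' : j + 1 = l)
    (x : P.X n i × P.X n (i - 1)) : D.extensionDiff h' (D.extensionDiff h x) = 0 := by
  simp [extensionDiff_apply, P.d_d,
    D.map_d h (by omega : i = j - 1) (by omega : j = l - 1) (by omega)]

theorem extensionDiff_act {n : ℕ} {i j : ℤ} (h : i + 1 = j) (σ : Equiv.Perm (Fin n))
    (x : P.X n i × P.X n (i - 1)) :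
    D.extensionDiff h ((P.act σ).prodMap (P.act σ) x) =
      (P.act σ).prodMap (P.act σ) (D.extensionDiff h x) := by
  simp [extensionDiff_apply, P.d_act, D.map_act]

theorem extensionDiff_one {j : ℤ} (h : 0 + 1 = j) : D.extensionDiff h (P.one, 0) = 0 := by
  rw [extensionDiff_apply]
  simp [P.d_one, D.map_one]

theorem extensionDiff_comp {m n p : ℕ} {i i' j j' l l' : ℤ} (hp : m + n = p + 1) (hd : i + j = l)
    (hi : i + 1 = i') (hj : j + 1 = j') (hl : l + 1 = l') (h₁ : i' + j = l') (h₂ : i + j' = l')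
    (a : Fin m) (f : P.X m i × P.X m (i - 1)) (g : P.X n j × P.X n (j - 1)) :
    D.extensionDiff hl (P.dualNumbersComp hp hd a f g) =
      P.dualNumbersComp hp h₁ a (D.extensionDiff hi f) g +
        i.negOnePow • P.dualNumbersComp hp h₂ a f (D.extensionDiff hj g) := by
  refine Prod.ext (P.d_comp hp hd hi hj hl h₁ h₂ a _ _) ?_
  have succ_sign : i'.negOnePow = -i.negOnePow := by rw [← hi, Int.negOnePow_succ]
  have pred_sign : (i - 1).negOnePow = -i.negOnePow := by
    rw [Int.negOnePow_sub, Int.negOnePow_one, mul_neg_one]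
  simp only [GradedOperad.dualNumbersComp_apply, extensionDiff_apply, map_add, map_sub,
    LinearMap.sub_apply, LinearMap.map_smul_of_tower, Prod.snd_add, Prod.smul_snd]
  rw [P.d_comp hp (by omega) (by omega : i - 1 + 1 = i' - 1) hj (by omega) (by omega)
      (by omega) a f.2,
    P.d_comp hp (by omega) hi (by omega : j - 1 + 1 = j' - 1) (by omega) (by omega)
      (by omega) a f.1 g.2,
    D.map_comp hp hd (by omega : i = i' - 1) (by omega : j = j' - 1) (by omega) (by omega)
      (by omega),
    succ_sign, pred_sign]
  simp only [smul_add, smul_sub, smul_smul, Int.units_mul_self, one_smul, Units.neg_smul]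
  abel

/-- Given a derivation `D` of `P`, the dg operad of operations `x + ε y` with `ε` of degree one,
`ε² = 0`, `d ε = 0`, and with the differential of `x` increased by `ε D x`. -/
noncomputable def extension : DGOperad.{v} k where
  toGradedOperad := P.toGradedOperad.dualNumbers
  d := D.extensionDiff
  d_d := D.extensionDiff_extensionDiff
  d_act := D.extensionDiff_act
  d_one := D.extensionDiff_one
  d_comp := D.extensionDiff_comp

/-- The evaluation of the operations of `D.extension` at `ε = 0`. -/
noncomputable def projection : D.extension ⟶ P :=
  Hom.mk
    { map := fun _ _ => LinearMap.fst k _ _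
      map_act := fun _ _ => rfl
      map_one := rfl
      map_comp := fun _ _ _ _ _ => rfl }
    (fun _ _ => rfl)

end Derivation

/-- The derivation `d/ds` of `P ⊗ k[s]`. -/
noncomputable def polynomialDerivation (P : DGOperad.{v} k) : Derivation (P.polynomial ℕ) where
  map h := h ▸ formalDeriv (R := k)
  map_act h σ f := by
    subst h
    exact formalDeriv_mapRange _ f
  map_one h := by
    subst h
    exact (formalDeriv_single 0 P.one).trans
      (by rw [Nat.cast_zero, zero_smul, Finsupp.single_zero]; rfl)
  map_comp hp hd hi hj hl h₁ h₂ a f g := by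
    subst hi hj hl
    exact formalDeriv_convolution _ f g
  map_d h hi hj h' f := by
    subst hi hj
    exact formalDeriv_mapRange _ f

/-- The path object `P ⊗ k[s, ds]` of `P`, in which `ds` is the element `ε` of the extension of
`P ⊗ k[s]` by the derivation `d/ds`. -/
noncomputable def path (P : DGOperad.{v} k) : DGOperad.{v} k :=
  P.polynomialDerivation.extension

section Path

variable {P : DGOperad.{v} k} {n : ℕ} {i : ℤ}

/-- The path `a(s) + ds b(s)`. -/
def pathMk (a : ℕ →₀ P.X n i) (b : ℕ →₀ P.X n (i - 1)) : P.path.X n i :=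
  (a, b)

theorem exists_pathMk_eq (γ : P.path.X n i) : ∃ a b, pathMk a b = γ :=
  ⟨γ.1, γ.2, rfl⟩

variable (P) in
/-- The value of a path at `s = c`. -/
noncomputable def pathEval (c : k) : P.path ⟶ P :=
  P.polynomialDerivation.projection ≫ P.polynomialEval (powersHom k c)

/-- The integral of the component `ds b(s)` of a path from `s = 0` to `s = 1`. -/
noncomputable def pathIntegral : P.path.X n i →ₗ[k] P.X n (i - 1) :=
  evalAt (1 : k) ∘ₗ formalIntegral (K := k) ∘ₗ LinearMap.snd k (ℕ →₀ P.X n i) (ℕ →₀ P.X n (i - 1))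

theorem pathEval_pathMk (c : k) (a : ℕ →₀ P.X n i) (b : ℕ →₀ P.X n (i - 1)) :
    (Hom.toHom (P.pathEval c)).map n i (pathMk a b) = evalAt c a :=
  rfl

theorem pathIntegral_pathMk (a : ℕ →₀ P.X n i) (b : ℕ →₀ P.X n (i - 1)) :
    pathIntegral (pathMk a b) = evalAt (1 : k) (formalIntegral (K := k) b) :=
  rfl

theorem d_pathMk (a : ℕ →₀ P.X n (i - 1)) (b : ℕ →₀ P.X n (i - 1 - 1)) :
    P.path.d (sub_add_cancel i 1) (pathMk a b) =
      pathMk (Finsupp.mapRange.linearMap (P.d (sub_add_cancel i 1)) a)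
        (formalDeriv (R := k) a -
          Finsupp.mapRange.linearMap (P.d (sub_add_cancel (i - 1) 1)) b) :=
  rfl

/-- The constant path at `x`. -/
noncomputable def constPath (x : P.X n i) : P.path.X n i :=
  pathMk (Finsupp.single 0 x) 0

/-- The path `s x` from zero to `x`. -/
noncomputable def linearPath (x : P.X n i) : P.path.X n i :=
  pathMk (Finsupp.single 1 x) 0

theorem pathEval_constPath (c : k) (x : P.X n i) :
    (Hom.toHom (P.pathEval c)).map n i (constPath x) = x := by
  simp [constPath, pathEval_pathMk]

theorem pathEval_linearPath (c : k) (x : P.X n i) :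
    (Hom.toHom (P.pathEval c)).map n i (linearPath x) = c • x := by
  simp [linearPath, pathEval_pathMk]

theorem d_constPath {j : ℤ} (h : i + 1 = j) (x : P.X n i) :
    P.path.d h (constPath x) = constPath (P.d h x) := by
  obtain rfl : i = j - 1 := by omega
  simp [constPath, d_pathMk]

theorem formalDeriv_eq_of_pathMk_mem_cycles {a : ℕ →₀ P.X n i} {b : ℕ →₀ P.X n (i - 1)}
    (h : pathMk a b ∈ P.path.cycles n i) :
    formalDeriv (R := k) a = Finsupp.mapRange.linearMap (P.d (sub_add_cancel i 1)) b := by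
  have snd_d : ∀ {j : ℤ} (h : i = j) (h' : i - 1 + 1 = j),
      P.polynomialDerivation.map h a - (P.polynomial ℕ).d h' b = 0 →
      formalDeriv (R := k) a = Finsupp.mapRange.linearMap (P.d (sub_add_cancel i 1)) b := by
    rintro _ rfl _
    exact sub_eq_zero.1
  exact snd_d _ _ (congrArg Prod.snd h)

variable [CharZero k]

theorem mapRange_d_formalIntegral_add {a : ℕ →₀ P.X n i} {b : ℕ →₀ P.X n (i - 1)}
    (h : pathMk a b ∈ P.path.cycles n i) :
    Finsupp.mapRange.linearMap (P.d (sub_add_cancel i 1)) (formalIntegral (K := k) b) +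
      Finsupp.single 0 (evalAt (0 : k) a) = a := by
  rw [← formalIntegral_mapRange, ← formalDeriv_eq_of_pathMk_mem_cycles h,
    formalIntegral_formalDeriv_add]

theorem pathEval_one_eq_of_mem_cycles {γ : P.path.X n i} (h : γ ∈ P.path.cycles n i) :
    (Hom.toHom (P.pathEval 1)).map n i γ =
      (Hom.toHom (P.pathEval 0)).map n i γ + P.d (sub_add_cancel i 1) (pathIntegral γ) := by
  obtain ⟨a, b, rfl⟩ := exists_pathMk_eq γ
  have eval_one := congrArg (evalAt (1 : k)) (mapRange_d_formalIntegral_add h)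
  rw [map_add, characterEval_mapRange, characterEval_single, ofAdd_zero,
    map_one (powersHom k (1 : k)), one_smul, add_comm] at eval_one
  exact eval_one.symm

theorem exists_path_d_eq_of_mem_cycles {γ : P.path.X n i} (h : γ ∈ P.path.cycles n i)
    {u : P.X n (i - 1)}
    (hu : P.d (sub_add_cancel i 1) u = (Hom.toHom (P.pathEval 0)).map n i γ) :
    ∃ δ : P.path.X n (i - 1), P.path.d (sub_add_cancel i 1) δ = γ ∧
      (Hom.toHom (P.pathEval 0)).map n (i - 1) δ = u ∧
      (Hom.toHom (P.pathEval 1)).map n (i - 1) δ = u + pathIntegral γ := by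
  obtain ⟨a, b, rfl⟩ := exists_pathMk_eq γ
  rw [pathEval_pathMk] at hu
  refine ⟨pathMk (Finsupp.single 0 u + formalIntegral (K := k) b) 0, ?_, ?_, ?_⟩
  · rw [d_pathMk]
    congr 1
    · rw [map_add, Finsupp.mapRange.linearMap_apply, Finsupp.mapRange_single, hu, add_comm,
        mapRange_d_formalIntegral_add h]
    · simp [formalDeriv_formalIntegral]
  · simp [pathEval_pathMk, evalAt_zero_formalIntegral]
  · simp [pathEval_pathMk, pathIntegral_pathMk]

end Path

section QuasiIso

variable {P Q : DGOperad.{v} k} {n : ℕ} {i : ℤ}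

theorem H.mk_eq_mk {x y : P.cycles n i} :
    (H.mk x : P.H n i) = H.mk y ↔ x.1 - y.1 ∈ P.boundaries n i :=
  Submodule.Quotient.eq _

theorem H.mk_eq_zero {x : P.cycles n i} : (H.mk x : P.H n i) = 0 ↔ x.1 ∈ P.boundaries n i :=
  Submodule.Quotient.mk_eq_zero _

theorem Hom.map_mem_cycles (f : P ⟶ Q) {x : P.X n i} (hx : x ∈ P.cycles n i) :
    (Hom.toHom f).map n i x ∈ Q.cycles n i := by
  rw [mem_cycles rfl] at hx ⊢
  rw [← Hom.map_d f, hx, map_zero]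

theorem Hom.map_mem_boundaries (f : P ⟶ Q) {x : P.X n i} (hx : x ∈ P.boundaries n i) :
    (Hom.toHom f).map n i x ∈ Q.boundaries n i := by
  obtain ⟨y, rfl⟩ := hx
  rw [Hom.map_d f]
  exact d_mem_boundaries _ _

theorem homologyFunctor_map_mk (f : P ⟶ Q) (x : P.cycles n i) :
    GradedOperad.Hom.map ((homologyFunctor k).map f) n i (H.mk x) =
      (H.mk ⟨(Hom.toHom f).map n i x.1, f.map_mem_cycles x.2⟩ : Q.H n i) :=
  rfl

theorem quasiIso_of_cycles (f : P ⟶ Q)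
    (inj : ∀ (n : ℕ) (i : ℤ), ∀ x ∈ P.cycles n i,
      (Hom.toHom f).map n i x ∈ Q.boundaries n i → x ∈ P.boundaries n i)
    (surj : ∀ (n : ℕ) (i : ℤ), ∀ y ∈ Q.cycles n i,
      ∃ x ∈ P.cycles n i, (Hom.toHom f).map n i x = y) :
    QuasiIso f := by
  intro n i
  constructor
  · refine (injective_iff_map_eq_zero _).2 fun x => ?_
    induction x using H.ind with | h x =>
    rw [homologyFunctor_map_mk]
    exact fun hx => H.mk_eq_zero.2 (inj n i x.1 x.2 (H.mk_eq_zero.1 hx))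
  · intro y
    induction y using H.ind with | h y =>
    obtain ⟨x, hx, hxy⟩ := surj n i y.1 y.2
    exact ⟨H.mk ⟨x, hx⟩, (homologyFunctor_map_mk f _).trans (congrArg H.mk (Subtype.ext hxy))⟩

end QuasiIso

/-- A family of subspaces of a dg operad that is closed under all the operations. -/
structure Suboperad (P : DGOperad.{v} k) where
  carrier : ∀ n i, Submodule k (P.X n i)
  act_mem : ∀ {n : ℕ} {i : ℤ} (σ : Equiv.Perm (Fin n)) {x : P.X n i},
    x ∈ carrier n i → P.act σ x ∈ carrier n i
  one_mem : P.one ∈ carrier 1 0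
  comp_mem : ∀ {m n p : ℕ} {i j l : ℤ} (hp : m + n = p + 1) (hd : i + j = l) (a : Fin m)
    {f : P.X m i} {g : P.X n j},
    f ∈ carrier m i → g ∈ carrier n j → P.comp hp hd a f g ∈ carrier p l
  d_mem : ∀ {n : ℕ} {i j : ℤ} (h : i + 1 = j) {x : P.X n i},
    x ∈ carrier n i → P.d h x ∈ carrier n j

namespace Suboperad

variable {P : DGOperad.{v} k} (S : P.Suboperad)

/-- A suboperad, regarded as a dg operad. -/
def toDGOperad : DGOperad.{v} k where
  X n i := S.carrier n i
  act σ := (P.act σ).restrict fun _ hx => S.act_mem σ hx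
  act_one _ := Subtype.ext (P.act_one _)
  act_mul _ _ _ := Subtype.ext (P.act_mul _ _ _)
  one := ⟨P.one, S.one_mem⟩
  comp hp hd a := LinearMap.mk₂ k (fun f g => ⟨P.comp hp hd a f.1 g.1, S.comp_mem hp hd a f.2 g.2⟩)
    (fun _ _ _ => Subtype.ext (by simp)) (fun _ _ _ => Subtype.ext (by simp))
    (fun _ _ _ => Subtype.ext (by simp)) (fun _ _ _ => Subtype.ext (by simp))
  one_comp _ _ _ _ := Subtype.ext (P.one_comp _ _ _ _)
  comp_one _ _ _ _ := Subtype.ext (P.comp_one _ _ _ _)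
  comp_assoc hp hs hq hs' hij ht hjl ht' a b c hc _ _ _ :=
    Subtype.ext (P.comp_assoc hp hs hq hs' hij ht hjl ht' a b c hc _ _ _)
  comp_comm hp hs hq hs' hij ht hil ht' a b hab b' hb' a' ha' _ _ _ :=
    Subtype.ext (P.comp_comm hp hs hq hs' hij ht hil ht' a b hab b' hb' a' ha' _ _ _)
  comp_act _ _ _ _ _ _ _ := Subtype.ext (P.comp_act _ _ _ _ _ _ _)
  d h := (P.d h).restrict fun _ hx => S.d_mem h hx
  d_d _ _ _ := Subtype.ext (P.d_d _ _ _)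
  d_act _ _ _ := Subtype.ext (P.d_act _ _ _)
  d_one _ := Subtype.ext (P.d_one _)
  d_comp hp hd hi hj hl h₁ h₂ a _ _ := Subtype.ext (P.d_comp hp hd hi hj hl h₁ h₂ a _ _)

/-- The inclusion of a suboperad. -/
def inclusion : S.toDGOperad ⟶ P :=
  Hom.mk
    { map := fun n i => (S.carrier n i).subtype
      map_act := fun _ _ => rfl
      map_one := rfl
      map_comp := fun _ _ _ _ _ => rfl }
    (fun _ _ => rfl)

end Suboperad

/-- A family of subcomplexes of a dg operad, indexed by a weight that is additive under
composition. The subcomplexes need not be independent of each other. -/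
structure WeightFamily (R : DGOperad.{v} k) where
  space : ∀ (_ : ℤ) n i, Submodule k (R.X n i)
  act_mem : ∀ {w : ℤ} {n : ℕ} {i : ℤ} (σ : Equiv.Perm (Fin n)) {γ : R.X n i},
    γ ∈ space w n i → R.act σ γ ∈ space w n i
  one_mem : R.one ∈ space 0 1 0
  comp_mem : ∀ {w w' : ℤ} {m n p : ℕ} {i j l : ℤ} (hp : m + n = p + 1) (hd : i + j = l)
    (a : Fin m) {γ : R.X m i} {δ : R.X n j},
    γ ∈ space w m i → δ ∈ space w' n j → R.comp hp hd a γ δ ∈ space (w + w') p l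
  d_mem : ∀ {w : ℤ} {n : ℕ} {i j : ℤ} (h : i + 1 = j) {γ : R.X n i},
    γ ∈ space w n i → R.d h γ ∈ space w n j

namespace WeightFamily

variable {R P : DGOperad.{v} k} (S : R.WeightFamily)

/-- The direct sum of the subcomplexes of a family, as a suboperad of the Laurent polynomials with
coefficients in `R`. -/
noncomputable def total : (R.polynomial ℤ).Suboperad where
  carrier n i := Finsupp.submodule fun w => S.space w n i
  act_mem σ _ hf w := S.act_mem σ (hf w)
  one_mem w := by
    by_cases hw : w = 0
    · rw [hw]
      exact (Finsupp.single_eq_same (a := (0 : ℤ)) (b := R.one)).symm ▸ S.one_mem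
    · exact (Finsupp.single_eq_of_ne (b := R.one) hw).symm ▸ zero_mem _
  comp_mem hp hd a _ _ hf hg :=
    convolution_apply_mem (R.comp hp hd a) (fun w => S.space w _ _)
      fun w w' => S.comp_mem hp hd a (hf w) (hg w')
  d_mem h _ hf w := S.d_mem h (hf w)

variable {S} {n : ℕ} {i : ℤ}

/-- The component of weight `w`. -/
noncomputable def part (w : ℤ) : S.total.toDGOperad.X n i →ₗ[k] R.X n i :=
  Finsupp.lapply w ∘ₗ Submodule.subtype (Finsupp.submodule fun w => S.space w n i)

/-- The inclusion of the component of weight `w`. -/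
noncomputable def single (w : ℤ) (γ : S.space w n i) : S.total.toDGOperad.X n i :=
  ⟨Finsupp.single w γ.1, fun w' => by
    by_cases hw : w' = w
    · rw [hw, Finsupp.single_eq_same]
      exact γ.2
    · rw [Finsupp.single_eq_of_ne hw]
      exact zero_mem _⟩

theorem part_mem (w : ℤ) (f : S.total.toDGOperad.X n i) : part w f ∈ S.space w n i :=
  f.2 w

theorem part_single_self (w : ℤ) (γ : S.space w n i) : part w (single w γ) = γ.1 :=
  Finsupp.single_eq_same

theorem part_d (w : ℤ) {j : ℤ} (h : i + 1 = j) (f : S.total.toDGOperad.X n i) :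
    part w (S.total.toDGOperad.d h f) = R.d h (part w f) :=
  rfl

theorem part_act (w : ℤ) (σ : Equiv.Perm (Fin n)) (f : S.total.toDGOperad.X n i) :
    part w (S.total.toDGOperad.act σ f) = R.act σ (part w f) :=
  rfl

theorem d_single (w : ℤ) {j : ℤ} (h : i + 1 = j) (γ : S.space w n i) :
    S.total.toDGOperad.d h (single w γ) = single w ⟨R.d h γ.1, S.d_mem h γ.2⟩ :=
  Subtype.ext (Finsupp.mapRange_single (hf := map_zero (R.d h)))

theorem part_mem_cycles (w : ℤ) {f : S.total.toDGOperad.X n i}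
    (hf : f ∈ S.total.toDGOperad.cycles n i) : part w f ∈ R.cycles n i := by
  rw [mem_cycles rfl] at hf ⊢
  rw [← part_d, hf, map_zero]

theorem sum_single_part (f : S.total.toDGOperad.X n i) :
    ∑ w ∈ Finsupp.support f.1, single w ⟨part w f, part_mem w f⟩ = f := by
  refine Subtype.ext ((AddSubmonoidClass.coe_finsetSum _ _).trans ?_)
  exact Finsupp.sum_single f.1

theorem mem_boundaries_of_part {f : S.total.toDGOperad.X n i}
    (h : ∀ w, ∃ δ ∈ S.space w n (i - 1), R.d (sub_add_cancel i 1) δ = part w f) :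
    f ∈ S.total.toDGOperad.boundaries n i := by
  rw [← sum_single_part f]
  refine Submodule.sum_mem _ fun w _ => ?_
  obtain ⟨δ, hδ, d_δ⟩ := h w
  refine (mem_boundaries (sub_add_cancel i 1)).2 ⟨single w ⟨δ, hδ⟩, ?_⟩
  simp only [d_single, d_δ]

variable (S) in
/-- The map from the direct sum of the subcomplexes of a family to their sum. -/
noncomputable def sumHom : S.total.toDGOperad ⟶ R :=
  S.total.inclusion ≫ R.polynomialEval 1

theorem sumHom_single (w : ℤ) (γ : S.space w n i) :
    (Hom.toHom S.sumHom).map n i (single w γ) = γ.1 :=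
  (characterEval_single 1 w γ.1).trans (one_smul k γ.1)

variable (S) in
/-- The subcomplex of weight `w` vanishes in degrees greater than `w`. -/
def IsTruncated : Prop :=
  ∀ ⦃w : ℤ⦄ ⦃n : ℕ⦄ ⦃i : ℤ⦄, w < i → ∀ γ ∈ S.space w n i, γ = 0

namespace IsTruncated

variable (hS : S.IsTruncated)
include hS

theorem mem_cycles {γ : R.X n i} (hγ : γ ∈ S.space i n i) : γ ∈ R.cycles n i :=
  (DGOperad.mem_cycles rfl).2 (hS (lt_add_one i) _ (S.d_mem rfl hγ))

theorem single_mem_cycles (γ : S.space i n i) : single i γ ∈ S.total.toDGOperad.cycles n i := by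
  rw [DGOperad.mem_cycles rfl, d_single]
  refine Subtype.ext ?_
  exact (congrArg (Finsupp.single i) ((DGOperad.mem_cycles rfl).1 (hS.mem_cycles γ.2))).trans
    (Finsupp.single_zero i)

theorem part_comp {m n p : ℕ} {i j l : ℤ} (hp : m + n = p + 1) (hd : i + j = l) (a : Fin m)
    (f : S.total.toDGOperad.X m i) (g : S.total.toDGOperad.X n j) :
    part l (S.total.toDGOperad.comp hp hd a f g) = R.comp hp hd a (part i f) (part j g) := by
  subst hd
  refine convolution_apply_add_of_unique (R.comp hp rfl a) (f := f.1) (g := g.1)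
    fun w w' hw hne => ?_
  have le_left : i ≤ w := by
    contrapose! hne
    exact (congrArg (R.comp hp rfl a · _) (hS hne _ (f.2 w))).trans (by simp)
  have le_right : j ≤ w' := by
    contrapose! hne
    exact (congrArg _ (hS hne _ (g.2 w'))).trans (map_zero _)
  omega

/-- The class of the image under `e` of the component of weight equal to the degree, which is a
cocycle by truncation. -/
noncomputable def diagonalHom (e : R ⟶ P) : S.total.toDGOperad ⟶ P.homology.toDGOperad :=
  Hom.mk
    { map := fun n i => H.mk ∘ₗ ((Hom.toHom e).map n i ∘ₗ part i).codRestrict _ fun f =>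
        e.map_mem_cycles (hS.mem_cycles (part_mem i f))
      map_act := fun σ f => congrArg H.mk (Subtype.ext
        ((congrArg _ (part_act _ σ f)).trans ((Hom.toHom e).map_act σ _)))
      map_one := congrArg H.mk (Subtype.ext
        ((congrArg _ Finsupp.single_eq_same).trans (Hom.toHom e).map_one))
      map_comp := fun hp hd a f g => congrArg H.mk (Subtype.ext
        ((congrArg _ (hS.part_comp hp hd a f g)).trans ((Hom.toHom e).map_comp hp hd a _ _))) }
    (fun h f => H.mk_eq_zero.2 (e.map_mem_boundaries (d_mem_boundaries h (part _ f))))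

end IsTruncated

/-- The subcomplexes of a family are resolutions by `e` of the components of the cohomology of `P`:
the cohomology of the subcomplex of weight `w` is concentrated in degree `w`, where `e` identifies
it with that of `P`. -/
structure IsPureResolution (S : R.WeightFamily) (e : R ⟶ P) : Prop where
  isTruncated : S.IsTruncated
  exists_d_eq_of_ne : ∀ ⦃w : ℤ⦄ ⦃n : ℕ⦄ ⦃i : ℤ⦄, i ≠ w → ∀ γ ∈ S.space w n i, γ ∈ R.cycles n i →
    ∃ δ ∈ S.space w n (i - 1), R.d (sub_add_cancel i 1) δ = γ
  exists_d_eq_of_map_mem_boundaries : ∀ ⦃n : ℕ⦄ ⦃i : ℤ⦄, ∀ γ ∈ S.space i n i,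
    (Hom.toHom e).map n i γ ∈ P.boundaries n i →
    ∃ δ ∈ S.space i n (i - 1), R.d (sub_add_cancel i 1) δ = γ
  exists_map_eq : ∀ ⦃n : ℕ⦄ ⦃i : ℤ⦄, ∀ x ∈ P.cycles n i,
    ∃ γ ∈ S.space i n i, (Hom.toHom e).map n i γ = x

namespace IsPureResolution

variable {e : R ⟶ P} (h : S.IsPureResolution e)
include h

theorem mem_boundaries_of_map_part_mem_boundaries {f : S.total.toDGOperad.X n i}
    (hf : f ∈ S.total.toDGOperad.cycles n i)
    (hef : (Hom.toHom e).map n i (part i f) ∈ P.boundaries n i) :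
    f ∈ S.total.toDGOperad.boundaries n i := by
  refine mem_boundaries_of_part fun w => ?_
  by_cases hw : i = w
  · subst hw
    exact h.exists_d_eq_of_map_mem_boundaries _ (part_mem i f) hef
  · exact h.exists_d_eq_of_ne hw _ (part_mem w f) (part_mem_cycles w hf)

theorem sub_single_part_mem_boundaries {f : S.total.toDGOperad.X n i}
    (hf : f ∈ S.total.toDGOperad.cycles n i) :
    f - single i ⟨part i f, part_mem i f⟩ ∈ S.total.toDGOperad.boundaries n i := by
  refine h.mem_boundaries_of_map_part_mem_boundaries
    (sub_mem hf (h.isTruncated.single_mem_cycles _)) ?_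
  rw [map_sub, part_single_self, sub_self, map_zero]
  exact zero_mem _

theorem quasiIso_sumHom_comp : QuasiIso (S.sumHom ≫ e) := by
  refine quasiIso_of_cycles _ (fun n i f hf hef => ?_) fun n i x hx => ?_
  · refine h.mem_boundaries_of_map_part_mem_boundaries hf ?_
    have sub_mem_boundaries := (S.sumHom ≫ e).map_mem_boundaries
      (h.sub_single_part_mem_boundaries hf)
    rw [map_sub] at sub_mem_boundaries
    have map_single : (Hom.toHom (S.sumHom ≫ e)).map n i (single i ⟨part i f, part_mem i f⟩) =
        (Hom.toHom e).map n i (part i f) :=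
      congrArg _ (sumHom_single i _)
    rw [map_single] at sub_mem_boundaries
    exact (Submodule.sub_mem_iff_right _ hef).1 sub_mem_boundaries
  · obtain ⟨γ, hγ, rfl⟩ := h.exists_map_eq x hx
    exact ⟨single i ⟨γ, hγ⟩, h.isTruncated.single_mem_cycles _, congrArg _ (sumHom_single i _)⟩

theorem quasiIso_diagonalHom : QuasiIso (h.isTruncated.diagonalHom e) := by
  refine quasiIso_of_cycles _ (fun n i f hf hef => ?_) fun n i x _ => ?_
  · obtain ⟨y, hy⟩ := hef
    exact h.mem_boundaries_of_map_part_mem_boundaries hf (H.mk_eq_zero.1 hy.symm)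
  · change P.H n i at x
    induction x using H.ind with | h x =>
    obtain ⟨γ, hγ, map_γ⟩ := h.exists_map_eq x.1 x.2
    refine ⟨single i ⟨γ, hγ⟩, h.isTruncated.single_mem_cycles _, congrArg H.mk (Subtype.ext ?_)⟩
    exact (congrArg _ (part_single_self i _)).trans map_γ

theorem formal : P.Formal :=
  .trans _ _ _ (.symm _ _ (.rel _ _ ⟨_, h.quasiIso_sumHom_comp⟩))
    (.rel _ _ ⟨_, h.quasiIso_diagonalHom⟩)

end IsPureResolution

end WeightFamily

section Truncation

variable {R : DGOperad.{v} k} {n : ℕ} {i w : ℤ}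

/-- The canonical truncation of `R` to degrees at most `w`, which consists of cocycles in
degree `w`. -/
def truncation (R : DGOperad.{v} k) (w : ℤ) (n : ℕ) (i : ℤ) : Submodule k (R.X n i) where
  carrier := {x | (w < i → x = 0) ∧ (w = i → x ∈ R.cycles n i)}
  add_mem' hx hy :=
    ⟨fun h => by rw [hx.1 h, hy.1 h, add_zero], fun h => add_mem (hx.2 h) (hy.2 h)⟩
  zero_mem' := ⟨fun _ => rfl, fun _ => zero_mem _⟩
  smul_mem' c x hx :=
    ⟨fun h => by rw [hx.1 h, smul_zero], fun h => Submodule.smul_mem _ c (hx.2 h)⟩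

theorem mem_truncation_of_lt (h : i < w) (x : R.X n i) : x ∈ R.truncation w n i :=
  ⟨fun h' => absurd h' h.not_gt, fun h' => absurd h' h.ne'⟩

theorem mem_truncation_self {x : R.X n i} : x ∈ R.truncation i n i ↔ x ∈ R.cycles n i :=
  ⟨fun h => h.2 rfl, fun h => ⟨fun h' => absurd h' (lt_irrefl i), fun _ => h⟩⟩

theorem act_mem_truncation (σ : Equiv.Perm (Fin n)) {x : R.X n i} (hx : x ∈ R.truncation w n i) :
    R.act σ x ∈ R.truncation w n i :=
  ⟨fun h => by rw [hx.1 h, map_zero], fun h => act_mem_cycles σ (hx.2 h)⟩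

theorem comp_mem_truncation {w' : ℤ} {m p : ℕ} {j l : ℤ} (hp : m + n = p + 1) (hd : i + j = l)
    (a : Fin m) {f : R.X m i} {g : R.X n j} (hf : f ∈ R.truncation w m i)
    (hg : g ∈ R.truncation w' n j) : R.comp hp hd a f g ∈ R.truncation (w + w') p l := by
  rcases lt_trichotomy w i with hw | hw | hw
  · rw [hf.1 hw, map_zero, LinearMap.zero_apply]
    exact zero_mem _
  · refine ⟨fun h => ?_, fun h => comp_mem_cycles hp hd a (hf.2 hw) (hg.2 (by omega))⟩
    rw [hg.1 (by omega), map_zero]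
  · rcases lt_or_ge w' j with hw' | hw'
    · rw [hg.1 hw', map_zero]
      exact zero_mem _
    · exact mem_truncation_of_lt (by omega) _

theorem d_mem_truncation {j : ℤ} (h : i + 1 = j) {x : R.X n i} (hx : x ∈ R.truncation w n i) :
    R.d h x ∈ R.truncation w n j := by
  refine ⟨fun hw => ?_, fun _ => (mem_cycles rfl).2 (R.d_d _ _ _)⟩
  rcases (show w ≤ i by omega).lt_or_eq with hw | hw
  · rw [hx.1 hw, map_zero]
  · exact (mem_cycles h).1 (hx.2 hw)

/-- The canonical truncation of the subcomplex of weight `w` to degrees at most `w`, for all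
`w`. -/
def WeightFamily.truncate (S : R.WeightFamily) : R.WeightFamily where
  space w n i := S.space w n i ⊓ R.truncation w n i
  act_mem σ _ h := ⟨S.act_mem σ h.1, act_mem_truncation σ h.2⟩
  one_mem := ⟨S.one_mem, mem_truncation_self.2 (R.d_one _)⟩
  comp_mem hp hd a _ _ h h' :=
    ⟨S.comp_mem hp hd a h.1 h'.1, comp_mem_truncation hp hd a h.2 h'.2⟩
  d_mem h _ hγ := ⟨S.d_mem h hγ.1, d_mem_truncation h hγ.2⟩

theorem WeightFamily.truncate_isTruncated (S : R.WeightFamily) : S.truncate.IsTruncated :=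
  fun _ _ _ h _ hγ => hγ.2.1 h

end Truncation

section Eigenpath

variable {P : DGOperad.{v} k} {σ : P ⟶ P} {q : kˣ} {n : ℕ} {i w : ℤ}

/-- The homotopy eigenspaces of an endomorphism `σ`: the weight `w` part consists of the paths `γ`
with `σ γ(0) = q ^ w γ(1)`. -/
noncomputable def eigenpaths (σ : P ⟶ P) (q : kˣ) : P.path.WeightFamily where
  space w n i := LinearMap.eqLocus
    ((Hom.toHom σ).map n i ∘ₗ (Hom.toHom (P.pathEval 0)).map n i)
    (((q ^ w : kˣ) : k) • (Hom.toHom (P.pathEval 1)).map n i)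
  act_mem τ γ h := by
    have h' := congrArg (P.act τ) h
    simpa [GradedOperad.Hom.map_act] using h'
  one_mem := by simp [GradedOperad.Hom.map_one]
  comp_mem hp hd a γ δ h h' := by
    simp only [LinearMap.mem_eqLocus, LinearMap.comp_apply, LinearMap.smul_apply] at h h' ⊢
    rw [GradedOperad.Hom.map_comp, GradedOperad.Hom.map_comp, h, h', GradedOperad.Hom.map_comp]
    simp [smul_smul, zpow_add, mul_comm]
  d_mem hij γ h := by
    simp only [LinearMap.mem_eqLocus, LinearMap.comp_apply, LinearMap.smul_apply] at h ⊢
    rw [Hom.map_d, Hom.map_d, h, Hom.map_d, map_smul]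

theorem mem_eigenpaths {γ : P.path.X n i} :
    γ ∈ (eigenpaths σ q).space w n i ↔
      (Hom.toHom σ).map n i ((Hom.toHom (P.pathEval 0)).map n i γ) =
        ((q ^ w : kˣ) : k) • (Hom.toHom (P.pathEval 1)).map n i γ :=
  Iff.rfl

theorem exists_add_d_mem_eigenpaths {δ : P.path.X n i}
    (h : (Hom.toHom σ).map n i ((Hom.toHom (P.pathEval 0)).map n i δ) -
      ((q ^ w : kˣ) : k) • (Hom.toHom (P.pathEval 1)).map n i δ ∈ P.boundaries n i) :
    ∃ η, δ + P.path.d (sub_add_cancel i 1) η ∈ (eigenpaths σ q).space w n i ∧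
      (Hom.toHom (P.pathEval 0)).map n i (P.path.d (sub_add_cancel i 1) η) = 0 := by
  obtain ⟨t, ht⟩ := h
  have eval_zero : (Hom.toHom (P.pathEval 0)).map n i (P.path.d (sub_add_cancel i 1)
      (linearPath (((q ^ w : kˣ) : k)⁻¹ • t))) = 0 := by
    rw [Hom.map_d, pathEval_linearPath, zero_smul, map_zero]
  refine ⟨_, mem_eigenpaths.2 ?_, eval_zero⟩
  rw [map_add, eval_zero, add_zero, map_add, Hom.map_d (P.pathEval 1), pathEval_linearPath,
    one_smul, map_smul, ht, smul_add, smul_inv_smul₀ (Units.ne_zero _), add_sub_cancel]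

variable (hσ : (homologyFunctor k).map σ = P.homology.gradingHom q)
include hσ

theorem map_sub_zpow_smul_mem_boundaries {x : P.X n i} (hx : x ∈ P.cycles n i) :
    (Hom.toHom σ).map n i x - ((q ^ i : kˣ) : k) • x ∈ P.boundaries n i :=
  (H.mk_eq_mk (y := ((q ^ i : kˣ) : k) • ⟨x, hx⟩)).1
    congr(GradedOperad.Hom.map $hσ n i (H.mk ⟨x, hx⟩))

theorem mem_boundaries_of_map_sub_smul_mem_boundaries {c : k} (hc : ((q ^ i : kˣ) : k) ≠ c)
    {x : P.X n i} (hx : x ∈ P.cycles n i)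
    (h : (Hom.toHom σ).map n i x - c • x ∈ P.boundaries n i) : x ∈ P.boundaries n i := by
  have smul_mem := sub_mem h (map_sub_zpow_smul_mem_boundaries hσ hx)
  rw [sub_sub_sub_cancel_left, ← sub_smul] at smul_mem
  exact (Submodule.smul_mem_iff _ (sub_ne_zero.2 hc)).1 smul_mem

theorem exists_map_sub_smul_sub_mem_boundaries {c : k} (hc : ((q ^ i : kˣ) : k) ≠ c)
    {x : P.X n i} (hx : x ∈ P.cycles n i) :
    ∃ z ∈ P.cycles n i, (Hom.toHom σ).map n i z - c • z - x ∈ P.boundaries n i := by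
  let r := ((q ^ i : kˣ) : k) - c
  have map_sub_smul_sub : (Hom.toHom σ).map n i (r⁻¹ • x) - c • r⁻¹ • x - x =
      r⁻¹ • ((Hom.toHom σ).map n i x - ((q ^ i : kˣ) : k) • x) :=
    calc
      _ = r⁻¹ • ((Hom.toHom σ).map n i x - c • x) - r⁻¹ • r • x := by
        rw [map_smul, smul_comm c, smul_sub, inv_smul_smul₀ (sub_ne_zero.2 hc)]
      _ = _ := by
        rw [← smul_sub, sub_smul, sub_sub, add_sub_cancel]
  refine ⟨r⁻¹ • x, Submodule.smul_mem _ _ hx, ?_⟩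
  rw [map_sub_smul_sub]
  exact Submodule.smul_mem _ _ (map_sub_zpow_smul_mem_boundaries hσ hx)

theorem exists_mem_eigenpaths_of_mem_cycles {x : P.X n i} (hx : x ∈ P.cycles n i) :
    ∃ γ ∈ (eigenpaths σ q).space i n i, γ ∈ P.path.cycles n i ∧
      (Hom.toHom (P.pathEval 0)).map n i γ = x := by
  have const_mem : constPath x ∈ P.path.cycles n i := by
    rw [mem_cycles rfl, d_constPath, (mem_cycles rfl).1 hx, constPath, Finsupp.single_zero]
    rfl
  obtain ⟨η, mem_eigenpaths, eval_zero⟩ :=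
    exists_add_d_mem_eigenpaths (σ := σ) (q := q) (w := i) (δ := constPath x) (by
      rw [pathEval_constPath, pathEval_constPath]
      exact map_sub_zpow_smul_mem_boundaries hσ hx)
  refine ⟨_, mem_eigenpaths, add_mem const_mem ((mem_cycles rfl).2 (P.path.d_d _ _ _)), ?_⟩
  rw [map_add, eval_zero, pathEval_constPath, add_zero]

variable [CharZero k]

theorem pathEval_zero_mem_boundaries_of_mem_eigenpaths (hw : q ^ i ≠ q ^ w) {γ : P.path.X n i}
    (hγ : γ ∈ (eigenpaths σ q).space w n i) (hγ' : γ ∈ P.path.cycles n i) :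
    (Hom.toHom (P.pathEval 0)).map n i γ ∈ P.boundaries n i := by
  refine mem_boundaries_of_map_sub_smul_mem_boundaries hσ (Units.val_injective.ne hw)
    ((P.pathEval 0).map_mem_cycles hγ') ?_
  rw [mem_eigenpaths.1 hγ, pathEval_one_eq_of_mem_cycles hγ', smul_add, add_sub_cancel_left]
  exact Submodule.smul_mem _ _ (d_mem_boundaries _ _)

theorem exists_mem_eigenpaths_d_eq (hw : q ^ (i - 1) ≠ q ^ w) {γ : P.path.X n i}
    (hγ : γ ∈ (eigenpaths σ q).space w n i) (hγ' : γ ∈ P.path.cycles n i)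
    (h : (Hom.toHom (P.pathEval 0)).map n i γ ∈ P.boundaries n i) :
    ∃ δ ∈ (eigenpaths σ q).space w n (i - 1), P.path.d (sub_add_cancel i 1) δ = γ := by
  obtain ⟨u, hu⟩ := h
  -- The obstruction to the eigenpath equation for the primitive of `γ` that starts at `u`.
  let e := (Hom.toHom σ).map n (i - 1) u - ((q ^ w : kˣ) : k) • (u + pathIntegral γ)
  have he : e ∈ P.cycles n (i - 1) := by
    rw [mem_cycles (sub_add_cancel i 1), map_sub, ← Hom.map_d σ, hu, map_smul, map_add, hu,
      ← pathEval_one_eq_of_mem_cycles hγ', sub_eq_zero]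
    exact hγ
  obtain ⟨z, hz, hze⟩ :=
    exists_map_sub_smul_sub_mem_boundaries hσ (Units.val_injective.ne hw) he
  obtain ⟨δ, d_δ, eval_zero, eval_one⟩ := exists_path_d_eq_of_mem_cycles hγ' (u := u - z) (by
    rw [map_sub, hu, (mem_cycles _).1 hz, sub_zero])
  obtain ⟨η, hη, -⟩ := exists_add_d_mem_eigenpaths (σ := σ) (q := q) (w := w) (δ := δ) (by
    convert neg_mem hze using 1
    rw [eval_zero, eval_one, map_sub]
    simp only [e, smul_add, smul_sub]
    abel)
  exact ⟨_, hη, by rw [map_add, P.path.d_d, add_zero, d_δ]⟩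

theorem truncate_eigenpaths_isPureResolution (hq : Function.Injective (q ^ · : ℤ → kˣ)) :
    (eigenpaths σ q).truncate.IsPureResolution (P.pathEval 0) where
  isTruncated := (eigenpaths σ q).truncate_isTruncated
  exists_d_eq_of_ne w n i hi γ hγ hγ' := by
    rcases lt_or_gt_of_ne hi with hi' | hi'
    · obtain ⟨δ, hδ, d_δ⟩ := exists_mem_eigenpaths_d_eq hσ (hq.ne (by omega)) hγ.1 hγ'
        (pathEval_zero_mem_boundaries_of_mem_eigenpaths hσ (hq.ne hi) hγ.1 hγ')
      exact ⟨δ, ⟨hδ, mem_truncation_of_lt (by omega) δ⟩, d_δ⟩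
    · exact ⟨0, zero_mem _, by rw [map_zero, hγ.2.1 hi']⟩
  exists_d_eq_of_map_mem_boundaries n i γ hγ h := by
    obtain ⟨δ, hδ, d_δ⟩ := exists_mem_eigenpaths_d_eq hσ (hq.ne (sub_one_lt i).ne) hγ.1
      (mem_truncation_self.1 hγ.2) h
    exact ⟨δ, ⟨hδ, mem_truncation_of_lt (sub_one_lt i) δ⟩, d_δ⟩
  exists_map_eq n i x hx := by
    obtain ⟨γ, hγ, hγ', eval_γ⟩ := exists_mem_eigenpaths_of_mem_cycles hσ hx
    exact ⟨γ, ⟨hγ, mem_truncation_self.2 hγ'⟩, eval_γ⟩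

end Eigenpath

end DGOperad

end Operadic

theorem mainTheorem2_general {k : Type u} [Field k] [CharZero k] (P : Operadic.DGOperad.{v} k)
    (q : kˣ) (hq : ∀ n : ℕ, 0 < n → q ^ n ≠ 1) (σ : P ⟶ P)
    (hσ : (Operadic.DGOperad.homologyFunctor k).map σ = P.homology.gradingHom q) : P.Formal := by
  have zpow_injective : Function.Injective (q ^ · : ℤ → kˣ) := by
    rw [injective_zpow_iff_not_isOfFinOrder, isOfFinOrder_iff_pow_eq_one]
    exact fun ⟨n, hn, hqn⟩ => hq n hn hqn
  exact (Operadic.DGOperad.truncate_eigenpaths_isPureResolution hσ zpow_injective).formal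

theorem mainTheorem2 {k : Type u} [Field k] [CharZero k]
    (P : Operadic.DGOperad.{max u v} k)
    (h0 : ∀ i : ℤ, Subsingleton (P.homology.X 0 i))
    (h1 : Nonempty (P.homology.X 1 0 ≃ₗ[k] k))
    (h1' : ∀ i : ℤ, i ≠ 0 → Subsingleton (P.homology.X 1 i))
    (q : kˣ) (hq : ∀ n : ℕ, 0 < n → q ^ n ≠ 1)
    (σ : P ≅ P)
    (hσ : (Operadic.DGOperad.homologyFunctor k).mapIso σ = P.homology.gradingAut q) :
    P.Formal :=
  mainTheorem2_general P q hq σ.hom (congrArg Iso.hom hσ)
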